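/- Let $G$ be a (real, finite-dimensional) Lie group with Lie algebra $\mathfrak g=T_eG$, and let $\|\cdot\|$ be a norm on $\mathfrak g$. A flow of automorphisms of $G$ is a continuous flow $(\varphi_t)_{t\in\mathbb R}$ on $G$ such that every $\varphi_t$ is a smooth automorphism of $G$. It is called contracting if there are constants $c,\mu>0$ such that $$\|(d\varphi_t)_eX\|\le c\,e^{-\mu t}\|X\|\qquad\text{for all }X\in\mathfrak g\text{ and all }t\ge 0,$$ and expanding if the flow $(\varphi_{-t})_{t\in\mathbb R}$ is contracting. (1) If $G$ is connected and admits a contracting or expanding flow of automorphisms, then $G$ is simply connected. (2) If $G$ is compact and of positive dimension, then $G$ admits no contracting or expanding flow of automorphisms. -/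

import Mathlib

open scoped Manifold ContDiff

noncomputable section LieGroupFlows

variable {E : Type*} [NormedAddCommGroup E] [NormedSpace ℝ E]
  {H : Type*} [TopologicalSpace H] (I : ModelWithCorners ℝ E H)
  {G : Type*} [TopologicalSpace G] [ChartedSpace H G] [Group G]

/-- A flow `(φ_t)_{t ∈ ℝ}` on a Lie group `G` is a flow of automorphisms if every `φ_t` is a smooth
group homomorphism. Since `φ_{-t}` is the inverse of `φ_t`, every `φ_t` is then an automorphism of
the Lie group `G`. (Joint continuity in `(t, g)` is part of the notion `Flow`.) -/
structure IsAutomorphismFlow (φ : Flow ℝ G) : Prop where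
  map_mul : ∀ (t : ℝ) (g h : G), φ t (g * h) = φ t g * φ t h
  contMDiff : ∀ t : ℝ, ContMDiff I I ∞ (φ t)

/-- The differential at the identity of a map `f : G → G` with `f 1 = 1`, as a self-map of the Lie
algebra `T_1 G`. The differential takes values in `T_{f 1} G`, which is the same space as `T_1 G`
because `f 1 = 1`; it is only used for such maps. -/
def differentialAtOne (f : G → G) (X : GroupLieAlgebra I G) : GroupLieAlgebra I G :=
  (mfderiv I I f 1 X : TangentSpace I (f 1))

/-- With respect to a norm `p` on the Lie algebra, the flow `φ` is contracting if there are
`c, μ > 0` with `p ((dφ_t)_1 X) ≤ c * e^{-μ t} * p X` for all `X` and all `t ≥ 0`. -/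
def IsContractingFlow (p : Seminorm ℝ (GroupLieAlgebra I G)) (φ : Flow ℝ G) : Prop :=
  ∃ c > (0 : ℝ), ∃ μ > (0 : ℝ), ∀ t : ℝ, 0 ≤ t → ∀ X : GroupLieAlgebra I G,
    p (differentialAtOne I (φ t) X) ≤ c * Real.exp (-μ * t) * p X

/-- A flow `φ` is expanding if the time-reversed flow `t ↦ φ_{-t} = (φ_t)⁻¹` is contracting. -/
def IsExpandingFlow (p : Seminorm ℝ (GroupLieAlgebra I G)) (φ : Flow ℝ G) : Prop :=
  IsContractingFlow I p φ.reverse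

end LieGroupFlows

open Set Filter Topology

/-! After reversing time if necessary, some time-`t` map `f` has a differential at `1` so small that
it halves small chart balls around `1`. These balls form a neighbourhood basis `U n` with `f (U n) ⊆
U (n + 1)`. The points attracted to `1` form a subgroup `W` containing `U 0`, so `W` is open and
hence closed, and each compact subset of `W` lies in some `f^[n] ⁻¹' U 0`. If `G` is connected, then
`W = G`, and every loop lies in a homeomorphic copy of the simply connected `U 0`. If `G` is
compact, so is `W`; a single `f^[n]` then sends all of `W` into `U 0`, which forces `U 0 ⊆ U 1`.
This is impossible for balls in positive dimension. -/

theorem Seminorm.exists_bounds_of_finiteDimensional {E : Type*} [NormedAddCommGroup E]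
    [NormedSpace ℝ E] [FiniteDimensional ℝ E] (p : Seminorm ℝ E) (hp : ∀ x, p x = 0 → x = 0) :
    ∃ a > 0, ∃ b > 0, ∀ x, a * ‖x‖ ≤ p x ∧ p x ≤ b * ‖x‖ := by
  have hc : Continuous p := by
    rw [← continuousOn_univ]
    exact p.convexOn.continuousOn isOpen_univ
  obtain ⟨b, hb, hpb⟩ := p.bound_of_continuous_normedSpace hc
  -- The unit sphere is empty only for trivial `E`, where any lower constant works.
  obtain h | hne := (Metric.sphere (0 : E) 1).eq_empty_or_nonempty
  · refine ⟨1, one_pos, b, hb, fun x => ⟨?_, hpb x⟩⟩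
    by_cases hx : x = 0
    · simp [hx]
    · have : ‖x‖⁻¹ • x ∈ Metric.sphere (0 : E) 1 := by simp [norm_smul, hx]
      simp [h] at this
  · obtain ⟨z, hz, hmin⟩ := (isCompact_sphere (0 : E) 1).exists_isMinOn hne hc.continuousOn
    have hz0 : z ≠ 0 := by rintro rfl; simp at hz
    refine ⟨p z, (apply_nonneg p z).lt_of_ne fun h => hz0 (hp z h.symm), b, hb,
      fun x => ⟨?_, hpb x⟩⟩
    by_cases hx : x = 0
    · simp [hx]
    · have hmem : ‖x‖⁻¹ • x ∈ Metric.sphere (0 : E) 1 := by simp [norm_smul, hx]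
      have h := hmin hmem
      simp only [mem_ofPred_eq, map_smul_eq_mul, norm_inv, norm_norm] at h
      have hx' : 0 < ‖x‖ := norm_pos_iff.2 hx
      rwa [inv_mul_eq_div, le_div_iff₀ hx'] at h

/-- Pairs of points and images of loops are compact, so paths and null-homotopies can be found
inside a single `V`. -/
theorem SimplyConnectedSpace.of_forall_isCompact {X : Type*} [TopologicalSpace X] [Nonempty X]
    (h : ∀ K : Set X, IsCompact K → ∃ V : Set X, IsSimplyConnected V ∧ K ⊆ V) :
    SimplyConnectedSpace X := by
  rw [simply_connected_iff_loops_nullhomotopic]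
  refine ⟨⟨‹_›, fun x y => ?_⟩, fun x γ => ?_⟩
  · obtain ⟨V, hV, hxy⟩ := h {x, y} (by simp)
    exact (hV.isPathConnected.joinedIn x (hxy (by simp)) y (hxy (by simp))).joined
  · obtain ⟨V, hV, hγ⟩ := h (range γ) (isCompact_range γ.continuous)
    obtain ⟨F, -⟩ := (isSimplyConnected_iff_exists_homotopy_refl_forall_mem.1 hV).2 x γ
      fun t => hγ (mem_range_self t)
    exact ⟨F⟩

/-! ### Contracting automorphisms of topological groups. -/

section TopologicalGroup

variable {G : Type*} [TopologicalSpace G] [Group G] [IsTopologicalGroup G]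

/-- The subgroup of points attracted to the identity under iteration of an automorphism. -/
def attractedSubgroup (f : G ≃ₜ* G) : Subgroup G where
  carrier := {x | Tendsto (fun n => f^[n] x) atTop (𝓝 1)}
  mul_mem' {x y} hx hy := by
    simpa [iterate_map_mul] using Tendsto.mul hx hy
  one_mem' := by simpa [iterate_map_one] using tendsto_const_nhds
  inv_mem' {x} hx := by
    simpa [iterate_map_inv] using Tendsto.inv hx

theorem mem_attractedSubgroup {f : G ≃ₜ* G} {x : G} :
    x ∈ attractedSubgroup f ↔ Tendsto (fun n => f^[n] x) atTop (𝓝 1) := Iff.rfl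

theorem apply_mem_attractedSubgroup_iff {f : G ≃ₜ* G} {x : G} :
    f x ∈ attractedSubgroup f ↔ x ∈ attractedSubgroup f := by
  simp only [mem_attractedSubgroup, ← Function.iterate_succ_apply]
  exact tendsto_add_atTop_iff_nat (f := fun n => f^[n] x) 1

theorem iterate_mem_attractedSubgroup_iff {f : G ≃ₜ* G} {x : G} (n : ℕ) :
    f^[n] x ∈ attractedSubgroup f ↔ x ∈ attractedSubgroup f := by
  induction n with
  | zero => rfl
  | succ n ih => rw [Function.iterate_succ_apply', apply_mem_attractedSubgroup_iff, ih]

/-- A neighbourhood basis `U` of the identity such that `f` maps each `U n` into `U (n + 1)`. -/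
structure IsContractedBasis (f : G ≃ₜ* G) (U : ℕ → Set G) : Prop where
  isOpen : ∀ n, IsOpen (U n)
  hasBasis : (𝓝 (1 : G)).HasAntitoneBasis U
  mapsTo : ∀ n, MapsTo f (U n) (U (n + 1))

namespace IsContractedBasis

variable {f : G ≃ₜ* G} {U : ℕ → Set G} (hU : IsContractedBasis f U)
include hU

omit [IsTopologicalGroup G] in
theorem iterate_mem {x : G} {m : ℕ} (hx : x ∈ U m) (n : ℕ) : f^[n] x ∈ U (m + n) := by
  induction n with
  | zero => exact hx
  | succ n ih =>
    rw [Function.iterate_succ_apply']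
    exact hU.mapsTo _ ih

theorem subset_attractedSubgroup : U 0 ⊆ attractedSubgroup f := fun x hx => by
  refine hU.hasBasis.tendsto_right_iff.2 fun i _ => ?_
  filter_upwards [eventually_ge_atTop i] with n hn
  exact hU.hasBasis.antitone hn (by simpa using hU.iterate_mem hx n)

theorem isOpen_attractedSubgroup : IsOpen (attractedSubgroup f : Set G) :=
  Subgroup.isOpen_of_mem_nhds _ (mem_of_superset (hU.hasBasis.mem 0) hU.subset_attractedSubgroup)

theorem exists_subset_preimage {K : Set G} (hK : IsCompact K)
    (hKW : K ⊆ attractedSubgroup f) : ∃ n, K ⊆ f^[n] ⁻¹' U 0 := by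
  -- The preimages increase because `f` maps `U 0` into `U 1 ⊆ U 0`; compactness then selects one of
  -- them.
  have hmono : Monotone fun n => f^[n] ⁻¹' U 0 := monotone_nat_of_le_succ fun n x hx => by
    rw [mem_preimage, Function.iterate_succ_apply']
    exact hU.hasBasis.antitone (Nat.le_succ 0) (hU.mapsTo 0 hx)
  refine hK.elim_directed_cover _
    (fun n => (hU.isOpen 0).preimage (f.continuous_toFun.iterate n)) (fun x hx => ?_)
    hmono.directed_le
  obtain ⟨n, hn⟩ := ((hKW hx).eventually (hU.hasBasis.mem 0)).exists
  exact mem_iUnion.2 ⟨n, hn⟩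

theorem simplyConnectedSpace [ConnectedSpace G] (h0 : IsSimplyConnected (U 0)) :
    SimplyConnectedSpace G := by
  have htop : (attractedSubgroup f : Set G) = univ :=
    IsClopen.eq_univ ⟨Subgroup.isClosed_of_isOpen _ hU.isOpen_attractedSubgroup,
      hU.isOpen_attractedSubgroup⟩ ⟨1, one_mem _⟩
  refine .of_forall_isCompact fun K hK => ?_
  obtain ⟨n, hn⟩ := hU.exists_subset_preimage hK (htop ▸ subset_univ K)
  refine ⟨_, ?_, hn⟩
  clear hn
  induction n with
  | zero => exact h0
  | succ n ih =>
    rw [Function.iterate_succ, preimage_comp]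
    exact f.toHomeomorph.isSimplyConnected_preimage.2 ih

theorem subset_of_compactSpace [CompactSpace G] (m : ℕ) : U 0 ⊆ U m := by
  have hK : IsCompact (attractedSubgroup f : Set G) :=
    (Subgroup.isClosed_of_isOpen _ hU.isOpen_attractedSubgroup).isCompact
  obtain ⟨n, hn⟩ := hU.exists_subset_preimage hK subset_rfl
  intro x hx
  -- The preimage `y` is still attracted, so `n` steps bring it into `U 0` and `m` more into `U m`.
  obtain ⟨y, rfl⟩ := (f.surjective.iterate (m + n)) x
  have hy := (iterate_mem_attractedSubgroup_iff (m + n)).1 (hU.subset_attractedSubgroup hx)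
  rw [Function.iterate_add_apply]
  simpa using hU.iterate_mem (hn hy) m

end IsContractedBasis

end TopologicalGroup


/-! ### Balls in a chart around an interior point. -/

section ChartBall

variable {E : Type*} [NormedAddCommGroup E] [NormedSpace ℝ E]
  {H : Type*} [TopologicalSpace H] (I : ModelWithCorners ℝ E H)
  {M : Type*} [TopologicalSpace M] [ChartedSpace H M]

/-- The points of the preferred chart domain at `x` whose coordinates have distance less than `r`
to those of `x`. -/
def chartBall (x : M) (r : ℝ) : Set M :=
  (extChartAt I x).source ∩ extChartAt I x ⁻¹' Metric.ball (extChartAt I x x) r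

variable {I}

theorem isOpen_chartBall (x : M) (r : ℝ) : IsOpen (chartBall I x r) :=
  isOpen_extChartAt_preimage' x Metric.isOpen_ball

theorem chartBall_mono (x : M) {r s : ℝ} (h : r ≤ s) : chartBall I x r ⊆ chartBall I x s :=
  inter_subset_inter_right _ (preimage_mono (Metric.ball_subset_ball h))

theorem chartBall_eq_image {x : M} {r : ℝ}
    (hr : Metric.ball (extChartAt I x x) r ⊆ (extChartAt I x).target) :
    chartBall I x r = (extChartAt I x).symm '' Metric.ball (extChartAt I x x) r :=
  ((extChartAt I x).symm_image_eq_source_inter_preimage hr).symm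

theorem isSimplyConnected_chartBall {x : M} {r : ℝ} (hr0 : 0 < r)
    (hr : Metric.ball (extChartAt I x x) r ⊆ (extChartAt I x).target) :
    IsSimplyConnected (chartBall I x r) := by
  have hmaps : MapsTo (extChartAt I x).symm (Metric.ball (extChartAt I x x) r)
      (chartBall I x r) := chartBall_eq_image hr ▸ mapsTo_image _ _
  let e : chartBall I x r ≃ₜ Metric.ball (extChartAt I x x) r :=
    { toFun := MapsTo.restrict (extChartAt I x) _ _ fun _ hy => hy.2
      invFun := MapsTo.restrict (extChartAt I x).symm _ _ hmaps
      left_inv := fun y => Subtype.ext ((extChartAt I x).left_inv y.2.1)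
      right_inv := fun y => Subtype.ext ((extChartAt I x).right_inv (hr y.2))
      continuous_toFun :=
        ((continuousOn_extChartAt x).mono inter_subset_left).mapsToRestrict _
      continuous_invFun := ((continuousOn_extChartAt_symm x).mono hr).mapsToRestrict _ }
  have : ContractibleSpace (Metric.ball (extChartAt I x x) r) :=
    (convex_ball _ _).contractibleSpace (Metric.nonempty_ball.2 hr0)
  exact e.toHomotopyEquiv.simplyConnectedSpace

theorem map_extChartAt_symm_nhds {x : M} (hx : I.IsInteriorPoint x) :
    map (extChartAt I x).symm (𝓝 (extChartAt I x x)) = 𝓝 x := by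
  rw [← map_extChartAt_symm_nhdsWithin_range (I := I) x,
    nhdsWithin_eq_nhds.2 (range_mem_nhds_isInteriorPoint hx)]

theorem extChartAt_target_mem_nhds_of_isInteriorPoint {x : M} (hx : I.IsInteriorPoint x) :
    (extChartAt I x).target ∈ 𝓝 (extChartAt I x x) := by
  rw [← nhdsWithin_eq_nhds.2 (range_mem_nhds_isInteriorPoint hx)]
  exact extChartAt_target_mem_nhdsWithin x

theorem hasAntitoneBasis_chartBall {x : M} (hx : I.IsInteriorPoint x) {r : ℝ} (hr0 : 0 < r)
    (hr : Metric.ball (extChartAt I x x) r ⊆ (extChartAt I x).target) :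
    (𝓝 x).HasAntitoneBasis fun n : ℕ => chartBall I x (r * 2⁻¹ ^ n) := by
  have hle (n : ℕ) : r * 2⁻¹ ^ n ≤ r :=
    mul_le_of_le_one_right hr0.le (pow_le_one₀ (by norm_num) (by norm_num))
  have hanti : Antitone fun n : ℕ => r * (2⁻¹ : ℝ) ^ n := fun m n hmn =>
    mul_le_mul_of_nonneg_left (pow_le_pow_of_le_one (by norm_num) (by norm_num) hmn) hr0.le
  have hlim : Tendsto (fun n : ℕ => r * (2⁻¹ : ℝ) ^ n) atTop (𝓝 0) := by
    simpa using (tendsto_pow_atTop_nhds_zero_of_lt_one (r := (2⁻¹ : ℝ)) (by norm_num)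
      (by norm_num)).const_mul r
  refine ⟨?_, fun m n hmn => chartBall_mono x (hanti hmn)⟩
  have hb : (𝓝 (extChartAt I x x)).HasBasis (fun _ : ℕ => True)
      fun n => Metric.ball (extChartAt I x x) (r * 2⁻¹ ^ n) := by
    refine Metric.nhds_basis_ball.to_hasBasis (fun ε hε => ?_) fun n _ => ⟨_, by positivity, subset_rfl⟩
    obtain ⟨n, hn⟩ := (hlim.eventually_lt_const hε).exists
    exact ⟨n, trivial, Metric.ball_subset_ball hn.le⟩
  have h := hb.map (extChartAt I x).symm
  rw [map_extChartAt_symm_nhds hx] at h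
  exact h.congr (fun _ => Iff.rfl) fun n _ =>
    (chartBall_eq_image ((Metric.ball_subset_ball (hle n)).trans hr)).symm

theorem exists_mem_chartBall_notMem [Nontrivial E] {x : M} {r s : ℝ} (hsr : s < r) (hr0 : 0 < r)
    (hr : Metric.ball (extChartAt I x x) r ⊆ (extChartAt I x).target) :
    ∃ y ∈ chartBall I x r, y ∉ chartBall I x s := by
  -- The maximum with `0` allows for negative `s`.
  obtain ⟨v, hv⟩ := exists_norm_eq E (le_max_right s 0)
  have hvr : extChartAt I x x + v ∈ Metric.ball (extChartAt I x x) r := by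
    simp [hv, hsr, hr0]
  refine ⟨(extChartAt I x).symm (extChartAt I x x + v), ?_, fun h => ?_⟩
  · rw [chartBall_eq_image hr]
    exact mem_image_of_mem _ hvr
  · have := h.2
    rw [mem_preimage, (extChartAt I x).right_inv (hr hvr)] at this
    simp [hv] at this

/-- A map fixing `x` whose differential at `x` has norm at most `1 / 4` contracts small chart balls
around `x` by the factor `1 / 2`. -/
theorem exists_mapsTo_chartBall {x : M} (hx : I.IsInteriorPoint x) {f : M → M} (hfx : f x = x)
    {L : E →L[ℝ] E} (hf : HasMFDerivAt I I f x L) (hL : ∀ v, ‖L v‖ ≤ 1 / 4 * ‖v‖) :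
    ∃ r > 0, Metric.ball (extChartAt I x x) r ⊆ (extChartAt I x).target ∧
      ∀ s ≤ r, MapsTo f (chartBall I x s) (chartBall I x (s * 2⁻¹)) := by
  set e := extChartAt I x
  have hd : HasFDerivAt (e ∘ f ∘ e.symm) L (e x) := by
    have h := hf.2
    simp only [writtenInExtChartAt, hfx] at h
    exact h.hasFDerivAt (range_mem_nhds_isInteriorPoint hx)
  have hex : e.symm (e x) = x := extChartAt_to_inv x
  have hsource : ∀ᶠ y in 𝓝 (e x), f (e.symm y) ∈ e.source := by
    have hc : ContinuousAt f x := hf.continuousAt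
    have h1 : Tendsto f (𝓝 x) (𝓝 x) := by simpa [ContinuousAt, hfx] using hc
    have h2 : Tendsto e.symm (𝓝 (e x)) (𝓝 x) := (map_extChartAt_symm_nhds hx).le
    exact (h1.comp h2).eventually (extChartAt_source_mem_nhds x)
  -- The remainder contributes `1 / 4` and `L` another `1 / 4`, giving the factor `1 / 2`.
  have hbound := hd.isLittleO.bound (c := 1 / 4) (by norm_num)
  obtain ⟨r, hr0, hr⟩ := Metric.eventually_nhds_iff_ball.1 (hsource.and (hbound.and
    (extChartAt_target_mem_nhds_of_isInteriorPoint hx)))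
  refine ⟨r, hr0, fun y hy => (hr y hy).2.2, fun s hs y hy => ?_⟩
  obtain ⟨h1, h2, -⟩ := hr _ (Metric.ball_subset_ball hs hy.2)
  simp only [Function.comp_apply, hex, hfx] at h2
  rw [e.left_inv hy.1] at h1 h2
  refine ⟨h1, ?_⟩
  have h3 : ‖e y - e x‖ < s := mem_ball_iff_norm.1 hy.2
  rw [mem_preimage, mem_ball_iff_norm]
  have h4 := hL (e y - e x)
  have h5 := norm_sub_norm_le (e (f y) - e x) (L (e y - e x))
  change ‖e (f y) - e x‖ < s * 2⁻¹
  change ‖e (f y) - e x - L (e y - e x)‖ ≤ 1 / 4 * ‖e y - e x‖ at h2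
  linarith

end ChartBall

/-! ### From contracting flows to contracted bases. -/

section Flow

variable {E : Type*} [NormedAddCommGroup E] [NormedSpace ℝ E]
  {H : Type*} [TopologicalSpace H] {I : ModelWithCorners ℝ E H}
  {G : Type*} [TopologicalSpace G] [ChartedSpace H G] [Group G]

/-- The time-`t` map of a flow of automorphisms, as an automorphism of the topological group. -/
def IsAutomorphismFlow.toContinuousMulEquiv {φ : Flow ℝ G} (hφ : IsAutomorphismFlow I φ) (t : ℝ) :
    G ≃ₜ* G where
  toFun := φ t
  invFun := φ (-t)
  left_inv x := by rw [← φ.map_add, neg_add_cancel, φ.map_zero_apply]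
  right_inv x := by rw [← φ.map_add, add_neg_cancel, φ.map_zero_apply]
  map_mul' := hφ.map_mul t
  continuous_toFun := φ.continuous_toFun t
  continuous_invFun := φ.continuous_toFun (-t)

theorem IsAutomorphismFlow.reverse {φ : Flow ℝ G} (hφ : IsAutomorphismFlow I φ) :
    IsAutomorphismFlow I φ.reverse where
  map_mul t := hφ.map_mul (-t)
  contMDiff t := hφ.contMDiff (-t)

theorem IsContractingFlow.exists_norm_differential_le [FiniteDimensional ℝ E]
    {p : Seminorm ℝ (GroupLieAlgebra I G)} (hp : ∀ X, p X = 0 → X = 0) {φ : Flow ℝ G}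
    (hφ : IsContractingFlow I p φ) (hd : ∀ t, MDifferentiableAt I I (φ t) 1)
    {ε : ℝ} (hε : 0 < ε) :
    ∃ (t : ℝ) (L : E →L[ℝ] E), HasMFDerivAt I I (φ t) 1 L ∧ ∀ v, ‖L v‖ ≤ ε * ‖v‖ := by
  obtain ⟨a, ha, b, hb, hab⟩ :=
    Seminorm.exists_bounds_of_finiteDimensional (E := E) p hp
  obtain ⟨c, hc, μ, hμ, h⟩ := hφ
  have hlim : Tendsto (fun t : ℝ => c * Real.exp (-μ * t) * b) atTop (𝓝 0) := by
    have := (Real.tendsto_exp_atBot.comp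
      (tendsto_id.const_mul_atTop_of_neg (neg_neg_of_pos hμ))).const_mul c
    simpa using this.mul_const b
  -- The bound `a * ε` absorbs the cost of passing from the model norm to `p` and back.
  obtain ⟨t, ht, ht0⟩ :=
    ((hlim.eventually_lt_const (mul_pos ha hε)).and (eventually_ge_atTop 0)).exists
  let L : E →L[ℝ] E := mfderiv I I (φ t) 1
  refine ⟨t, L, (hd t).hasMFDerivAt, fun v => ?_⟩
  have h1 := (hab (L v)).1
  have h2 : p (L v) ≤ c * Real.exp (-μ * t) * p v := h t ht0 v
  have h3 : c * Real.exp (-μ * t) * p v ≤ c * Real.exp (-μ * t) * (b * ‖v‖) :=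
    mul_le_mul_of_nonneg_left (hab v).2 (by positivity)
  have h4 := mul_le_mul_of_nonneg_right ht.le (norm_nonneg v)
  refine le_of_mul_le_mul_left (h1.trans (h2.trans (h3.trans ?_))) ha
  linarith

/-- A contracting flow of automorphisms contains an automorphism contracting the members of a
neighbourhood basis of the identity which starts at a simply connected set. -/
theorem IsContractingFlow.exists_isContractedBasis [FiniteDimensional ℝ E]
    [BoundarylessManifold I G] {p : Seminorm ℝ (GroupLieAlgebra I G)}
    (hp : ∀ X, p X = 0 → X = 0) {φ : Flow ℝ G} (hφ : IsAutomorphismFlow I φ)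
    (hc : IsContractingFlow I p φ) :
    ∃ (f : G ≃ₜ* G) (U : ℕ → Set G), IsContractedBasis f U ∧ IsSimplyConnected (U 0) ∧
      (0 < Module.finrank ℝ E → ¬ U 0 ⊆ U 1) := by
  obtain ⟨t, L, hL, hL'⟩ := hc.exists_norm_differential_le hp
    (fun t => (hφ.contMDiff t).mdifferentiable (by simp) 1) (ε := 1 / 4) (by norm_num)
  have hI : I.IsInteriorPoint (1 : G) := BoundarylessManifold.isInteriorPoint
  obtain ⟨r, hr0, hr, hmaps⟩ := exists_mapsTo_chartBall hI
    (map_one (hφ.toContinuousMulEquiv t)) hL hL'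
  refine ⟨hφ.toContinuousMulEquiv t, fun n => chartBall I 1 (r * 2⁻¹ ^ n),
    ⟨fun n => isOpen_chartBall _ _, hasAntitoneBasis_chartBall hI hr0 hr, fun n => ?_⟩, ?_, ?_⟩
  · rw [pow_succ, ← mul_assoc]
    exact hmaps _ (mul_le_of_le_one_right hr0.le (pow_le_one₀ (by norm_num) (by norm_num)))
  · simpa using isSimplyConnected_chartBall hr0 hr
  · intro hE
    have := Module.finrank_pos_iff.1 hE
    obtain ⟨y, hy, hy'⟩ := exists_mem_chartBall_notMem (s := r * 2⁻¹) (by linarith) hr0 hr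
    exact fun h => hy' (by simpa using h (by simpa using hy))

end Flow

theorem proposition2p2
    {E : Type*} [NormedAddCommGroup E] [NormedSpace ℝ E] [FiniteDimensional ℝ E]
    {H : Type*} [TopologicalSpace H] (I : ModelWithCorners ℝ E H)
    (G : Type*) [TopologicalSpace G] [ChartedSpace H G] [Group G]
    [LieGroup I ∞ G] [BoundarylessManifold I G]
    (p : Seminorm ℝ (GroupLieAlgebra I G)) (hp : ∀ X : GroupLieAlgebra I G, p X = 0 → X = 0) :
    (ConnectedSpace G →
      ∀ φ : Flow ℝ G, IsAutomorphismFlow I φ →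
        IsContractingFlow I p φ ∨ IsExpandingFlow I p φ → SimplyConnectedSpace G) ∧
    (CompactSpace G → 0 < Module.finrank ℝ E →
      ¬ ∃ φ : Flow ℝ G, IsAutomorphismFlow I φ ∧
        (IsContractingFlow I p φ ∨ IsExpandingFlow I p φ)) := by
  have : IsTopologicalGroup G := topologicalGroup_of_lieGroup I ∞
  have key (φ : Flow ℝ G) (hφ : IsAutomorphismFlow I φ)
      (h : IsContractingFlow I p φ ∨ IsExpandingFlow I p φ) :
      ∃ (f : G ≃ₜ* G) (U : ℕ → Set G), IsContractedBasis f U ∧ IsSimplyConnected (U 0) ∧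
        (0 < Module.finrank ℝ E → ¬ U 0 ⊆ U 1) :=
    h.elim (fun h => h.exists_isContractedBasis hp hφ)
      fun h => IsContractingFlow.exists_isContractedBasis hp hφ.reverse h
  refine ⟨fun _ φ hφ h => ?_, fun _ hE ⟨φ, hφ, h⟩ => ?_⟩
  · obtain ⟨f, U, hU, h0, -⟩ := key φ hφ h
    exact hU.simplyConnectedSpace h0
  · obtain ⟨f, U, hU, -, hne⟩ := key φ hφ h
    exact hne hE (hU.subset_of_compactSpace 1)
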